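/- An incidence matrix is a matrix with entries in $\{0,1\}$ (with any finite numbers of rows and columns) that has no zero row and no zero column. For $n\ge 0$ let $F_{1111}(n)$ be the number of incidence matrices with exactly $n$ entries equal to $1$, over all possible numbers of rows and columns, where matrices that differ by a permutation of rows or of columns are counted as different and repeated rows and columns are allowed. Then, as $n\to\infty$, $$F_{1111}(n)\sim\frac{n!}{4}\,e^{-\frac12(\log 2)^2}\,\frac{1}{(\log 2)^{2n+2}},$$ where $a_n\sim b_n$ means $\lim_{n\to\infty}a_n/b_n=1$. -/

import Mathlib

open Filter Topology

/-- An `r × s` incidence matrix with exactly `n` ones: a zero-one matrix with no zero row and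
no zero column. -/
structure IsIncidenceMatrix {r s : ℕ} (A : Matrix (Fin r) (Fin s) ℕ) (n : ℕ) : Prop where
  zero_or_one : ∀ i j, A i j = 0 ∨ A i j = 1
  row_ne_zero : ∀ i, ∃ j, A i j ≠ 0
  col_ne_zero : ∀ j, ∃ i, A i j ≠ 0
  card_ones : (Finset.univ.filter fun p : Fin r × Fin s => A p.1 p.2 = 1).card = n

/-- The incidence matrices with `n` ones, of all sizes `r × s`. Matrices that differ by a
permutation of rows or of columns are not identified; repeated rows and columns are allowed. -/
def IncidenceMatrices (n : ℕ) : Type :=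
  Σ (r : ℕ) (s : ℕ), {A : Matrix (Fin r) (Fin s) ℕ // IsIncidenceMatrix A n}

theorem IsIncidenceMatrix.rows_le {r s n : ℕ} {A : Matrix (Fin r) (Fin s) ℕ}
    (h : IsIncidenceMatrix A n) : r ≤ n := by
  choose f hf using h.row_ne_zero
  have key := Finset.card_le_card_of_injOn (s := (Finset.univ : Finset (Fin r)))
    (t := Finset.univ.filter fun p : Fin r × Fin s => A p.1 p.2 = 1) (fun i => (i, f i))
    (fun i _ => by simpa using (h.zero_or_one i (f i)).resolve_left (hf i))
    (fun i _ j _ hij => congrArg Prod.fst hij)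
  simpa [h.card_ones] using key

theorem IsIncidenceMatrix.cols_le {r s n : ℕ} {A : Matrix (Fin r) (Fin s) ℕ}
    (h : IsIncidenceMatrix A n) : s ≤ n := by
  choose f hf using h.col_ne_zero
  have key := Finset.card_le_card_of_injOn (s := (Finset.univ : Finset (Fin s)))
    (t := Finset.univ.filter fun p : Fin r × Fin s => A p.1 p.2 = 1) (fun j => (f j, j))
    (fun j _ => by simpa using (h.zero_or_one (f j) j).resolve_left (hf j))
    (fun i _ j _ hij => congrArg Prod.snd hij)
  simpa [h.card_ones] using key

/-- There are finitely many incidence matrices with `n` ones, so that the cardinality below is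
a genuine count. -/
instance IncidenceMatrices.instFinite (n : ℕ) : Finite (IncidenceMatrices n) := by
  let g : IncidenceMatrices n →
      Σ (r : Fin (n + 1)) (s : Fin (n + 1)), (Fin r.1 → Fin s.1 → Fin 2) := fun x =>
    ⟨⟨x.1, Nat.lt_succ_of_le x.2.2.2.rows_le⟩, ⟨x.2.1, Nat.lt_succ_of_le x.2.2.2.cols_le⟩,
      fun i j => ⟨x.2.2.1 i j, by rcases x.2.2.2.zero_or_one i j with h | h <;> omega⟩⟩
  refine Finite.of_injective g ?_
  rintro ⟨r, s, A, hA⟩ ⟨r', s', B, hB⟩ h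
  simp only [g, Sigma.mk.injEq, Fin.mk.injEq] at h
  obtain ⟨rfl, h⟩ := h
  simp only [heq_eq_eq, Sigma.mk.injEq, Fin.mk.injEq] at h
  obtain ⟨rfl, h⟩ := h
  have hAB : A = B := by
    ext i j
    have := congrFun (congrFun (eq_of_heq h) i) j
    simpa using this
  subst hAB
  rfl

/-- `F1111 n` is the number of incidence matrices with `n` ones. -/
noncomputable def F1111 (n : ℕ) : ℕ := Nat.card (IncidenceMatrices n)

/-! An `n`-subset of an `r × s` grid is an incidence matrix on the rows and columns it meets, so `(r
* s).choose n` is a binomial combination of the counts by size. Every binomial coefficient `r.choose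
i` has total weight 1 under `1 / 2 ^ (r + 1)`, hence `F1111 n` is the sum of `(r * s).choose n / 2 ^
(r + s + 2)` over all `r`, `s`. Expanding the falling factorial in powers of `r * s` separates the
two variables and gives `factorial_mul_F1111`, an alternating sum of `esymmRange n k * orderedBell
(n - k) ^ 2`.

With L = log 2, `orderedBell m` ~ m! / (2 L^(m+1)) and `esymmRange n k` ~ n^(2k) / (2^k k!). After
division by n! / (4 L^(2n+2)), the `k`-th term tends to (-L²/2)^k / k!, and dominated convergence
sums these limits to exp(-L²/2). -/

/-! ### Counting incidence matrices by size. -/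

/-- The number of `r × s` incidence matrices with `n` ones. -/
noncomputable def incidenceCount (r s n : ℕ) : ℕ :=
  Nat.card {A : Matrix (Fin r) (Fin s) ℕ // IsIncidenceMatrix A n}

theorem incidenceCount_eq_zero_of_lt_left {r s n : ℕ} (h : n < r) : incidenceCount r s n = 0 := by
  have : IsEmpty {A : Matrix (Fin r) (Fin s) ℕ // IsIncidenceMatrix A n} :=
    ⟨fun A => absurd A.2.rows_le (by omega)⟩
  exact Nat.card_of_isEmpty

theorem incidenceCount_eq_zero_of_lt_right {r s n : ℕ} (h : n < s) :
    incidenceCount r s n = 0 := by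
  have : IsEmpty {A : Matrix (Fin r) (Fin s) ℕ // IsIncidenceMatrix A n} :=
    ⟨fun A => absurd A.2.cols_le (by omega)⟩
  exact Nat.card_of_isEmpty

instance finite_isIncidenceMatrix (r s n : ℕ) :
    Finite {A : Matrix (Fin r) (Fin s) ℕ // IsIncidenceMatrix A n} :=
  Finite.of_injective (β := IncidenceMatrices n) (fun A => ⟨r, s, A⟩) fun A B h => by
    cases h; rfl

theorem F1111_eq_sum_incidenceCount (n : ℕ) :
    F1111 n = ∑ i ∈ Finset.range (n + 1), ∑ j ∈ Finset.range (n + 1), incidenceCount i j n := by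
  let e : IncidenceMatrices n ≃ Σ (r : Fin (n + 1)) (s : Fin (n + 1)),
      {A : Matrix (Fin r) (Fin s) ℕ // IsIncidenceMatrix A n} :=
    { toFun := fun x => ⟨⟨x.1, Nat.lt_succ_of_le x.2.2.2.rows_le⟩,
        ⟨x.2.1, Nat.lt_succ_of_le x.2.2.2.cols_le⟩, x.2.2⟩
      invFun := fun x => ⟨x.1, x.2.1, x.2.2⟩
      left_inv := fun _ => rfl
      right_inv := fun _ => rfl }
  rw [F1111, Nat.card_congr e, Nat.card_sigma, Finset.sum_range]
  refine Finset.sum_congr rfl fun i _ => ?_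
  rw [Nat.card_sigma, Finset.sum_range]
  rfl

/-- The `n`-element subsets of `Fin r × Fin s` with prescribed projections. -/
def setsWithProjections (n : ℕ) {r s : ℕ} (I : Finset (Fin r)) (J : Finset (Fin s)) :
    Finset (Finset (Fin r × Fin s)) :=
  (Finset.powersetCard n Finset.univ).filter fun S => S.image Prod.fst = I ∧ S.image Prod.snd = J

theorem mem_setsWithProjections {n r s : ℕ} {I : Finset (Fin r)} {J : Finset (Fin s)}
    {S : Finset (Fin r × Fin s)} : S ∈ setsWithProjections n I J ↔
      S.card = n ∧ S.image Prod.fst = I ∧ S.image Prod.snd = J := by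
  simp [setsWithProjections, Finset.mem_powersetCard]

theorem incidenceCount_eq_card (r s n : ℕ) : incidenceCount r s n =
    (setsWithProjections n (Finset.univ : Finset (Fin r)) (Finset.univ : Finset (Fin s))).card := by
  let e : {A : Matrix (Fin r) (Fin s) ℕ // IsIncidenceMatrix A n} ≃
      {S // S ∈ setsWithProjections n (Finset.univ : Finset (Fin r))
        (Finset.univ : Finset (Fin s))} :=
    { toFun := fun A => ⟨Finset.univ.filter fun p => A.1 p.1 p.2 = 1, by
        obtain ⟨A, hA⟩ := A
        refine mem_setsWithProjections.2 ⟨hA.card_ones, ?_, ?_⟩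
        · refine Finset.eq_univ_iff_forall.2 fun i => ?_
          obtain ⟨j, hj⟩ := hA.row_ne_zero i
          exact Finset.mem_image.2
            ⟨(i, j), by simpa using (hA.zero_or_one i j).resolve_left hj, rfl⟩
        · refine Finset.eq_univ_iff_forall.2 fun j => ?_
          obtain ⟨i, hi⟩ := hA.col_ne_zero j
          exact Finset.mem_image.2
            ⟨(i, j), by simpa using (hA.zero_or_one i j).resolve_left hi, rfl⟩⟩
      invFun := fun S => ⟨fun i j => if (i, j) ∈ S.1 then 1 else 0, by
        obtain ⟨S, hS⟩ := S
        obtain ⟨hn, h1, h2⟩ := mem_setsWithProjections.1 hS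
        refine ⟨fun i j => ?_, fun i => ?_, fun j => ?_, ?_⟩
        · by_cases h : (i, j) ∈ S <;> simp [h]
        · obtain ⟨⟨i', j⟩, hp, rfl⟩ := Finset.mem_image.1 (h1 ▸ Finset.mem_univ i)
          exact ⟨j, by simp [hp]⟩
        · obtain ⟨⟨i, j'⟩, hp, rfl⟩ := Finset.mem_image.1 (h2 ▸ Finset.mem_univ j)
          exact ⟨i, by simp [hp]⟩
        · simpa using hn⟩
      left_inv := fun A => by
        ext i j
        rcases A.2.zero_or_one i j with h | h <;> simp [h]
      right_inv := fun S => by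
        ext p
        simp }
  rw [incidenceCount, Nat.card_congr e, Nat.card_eq_fintype_card, Fintype.card_coe]

/-- The increasing enumerations of `I` and `J` carry subsets of the small grid that meet every row
and column onto subsets of `I ×ˢ J` with full projections. -/
theorem card_setsWithProjections {n r s : ℕ} (I : Finset (Fin r)) (J : Finset (Fin s)) :
    (setsWithProjections n I J).card = incidenceCount I.card J.card n := by
  rw [incidenceCount_eq_card]
  symm
  let e : Fin I.card × Fin J.card ↪ Fin r × Fin s :=
    (I.orderEmbOfFin rfl).toEmbedding.prodMap (J.orderEmbOfFin rfl).toEmbedding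
  have hI : (Finset.univ : Finset (Fin I.card)).image (I.orderEmbOfFin rfl) = I :=
    Finset.image_orderEmbOfFin_univ I rfl
  have hJ : (Finset.univ : Finset (Fin J.card)).image (J.orderEmbOfFin rfl) = J :=
    Finset.image_orderEmbOfFin_univ J rfl
  have hfst (T : Finset (Fin I.card × Fin J.card)) :
      (T.map e).image Prod.fst = (T.image Prod.fst).image (I.orderEmbOfFin rfl) := by
    rw [Finset.map_eq_image, Finset.image_image, Finset.image_image]; rfl
  have hsnd (T : Finset (Fin I.card × Fin J.card)) :
      (T.map e).image Prod.snd = (T.image Prod.snd).image (J.orderEmbOfFin rfl) := by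
    rw [Finset.map_eq_image, Finset.image_image, Finset.image_image]; rfl
  refine Finset.card_bij (fun T _ => T.map e) (fun T hT => ?_)
    (fun T _ T' _ h => Finset.map_injective e h) (fun S hS => ?_)
  · rw [mem_setsWithProjections] at hT ⊢
    rw [Finset.card_map, hfst, hsnd, hT.2.1, hT.2.2]
    exact ⟨hT.1, hI, hJ⟩
  · rw [mem_setsWithProjections] at hS
    obtain ⟨hn, h1, h2⟩ := hS
    have hsub : S ⊆ Finset.univ.map e := fun p hp => by
      have hp1 : p.1 ∈ I := h1 ▸ Finset.mem_image_of_mem _ hp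
      have hp2 : p.2 ∈ J := h2 ▸ Finset.mem_image_of_mem _ hp
      rw [← hI, Finset.mem_image] at hp1
      rw [← hJ, Finset.mem_image] at hp2
      obtain ⟨i, -, hi⟩ := hp1
      obtain ⟨j, -, hj⟩ := hp2
      exact Finset.mem_map.2 ⟨(i, j), Finset.mem_univ _, Prod.ext hi hj⟩
    obtain ⟨T, -, rfl⟩ := Finset.subset_map_iff.1 hsub
    refine ⟨T, ?_, rfl⟩
    rw [hfst] at h1
    rw [hsnd] at h2
    rw [mem_setsWithProjections]
    refine ⟨by simpa using hn, ?_, ?_⟩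
    · exact Finset.image_injective (I.orderEmbOfFin rfl).injective (h1.trans hI.symm)
    · exact Finset.image_injective (J.orderEmbOfFin rfl).injective (h2.trans hJ.symm)

theorem choose_mul_eq_sum_incidenceCount (r s n : ℕ) :
    (r * s).choose n = ∑ i ∈ Finset.range (n + 1), ∑ j ∈ Finset.range (n + 1),
      r.choose i * s.choose j * incidenceCount i j n := by
  have h1 : (r * s).choose n =
      (Finset.powersetCard n (Finset.univ : Finset (Fin r × Fin s))).card := by simp
  have h2 : (r * s).choose n = ∑ i ∈ Finset.range (r + 1), ∑ j ∈ Finset.range (s + 1),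
      r.choose i * s.choose j * incidenceCount i j n := by
    rw [h1, Finset.card_eq_sum_card_fiberwise
      (f := fun S => (S.image Prod.fst, S.image Prod.snd))
      (t := (Finset.univ : Finset (Fin r)).powerset ×ˢ (Finset.univ : Finset (Fin s)).powerset)
      (fun S _ => by simp), Finset.sum_product]
    have h3 (I : Finset (Fin r)) (J : Finset (Fin s)) :
        ((Finset.powersetCard n (Finset.univ : Finset (Fin r × Fin s))).filter
          fun S => (S.image Prod.fst, S.image Prod.snd) = (I, J)).card =
            incidenceCount I.card J.card n := by
      rw [← card_setsWithProjections]
      simp only [setsWithProjections, Prod.mk.injEq]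
    simp only [h3]
    have h4 (i : ℕ) : ∑ J ∈ (Finset.univ : Finset (Fin s)).powerset, incidenceCount i J.card n =
        ∑ j ∈ Finset.range (s + 1), s.choose j * incidenceCount i j n := by
      simpa using Finset.sum_powerset_apply_card (fun j => incidenceCount i j n)
        (x := (Finset.univ : Finset (Fin s)))
    simp only [h4]
    have h5 := Finset.sum_powerset_apply_card
      (fun i => ∑ j ∈ Finset.range (s + 1), s.choose j * incidenceCount i j n)
      (x := (Finset.univ : Finset (Fin r)))
    rw [h5]
    simp [Finset.mul_sum, mul_assoc]
  -- Summing up to `n` instead of `r` or `s` changes nothing, and makes the index range independent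
  -- of the grid, so that the sum over `r`, `s` can later be taken termwise.
  have key (f : ℕ → ℕ) (a : ℕ) (h : ∀ i, n < i → f i = 0) (h' : ∀ i, a < i → f i = 0) :
      ∑ i ∈ Finset.range (a + 1), f i = ∑ i ∈ Finset.range (n + 1), f i := by
    rcases le_total a n with hn | hn
    · exact Finset.sum_subset (by simpa using hn) fun i _ hi => h' i (by simpa using hi)
    · exact (Finset.sum_subset (by simpa using hn) fun i _ hi => h i (by simpa using hi)).symm
  rw [h2, key _ r (fun i hi => by simp [incidenceCount_eq_zero_of_lt_left hi])
    (fun i hi => by simp [Nat.choose_eq_zero_of_lt hi])]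
  refine Finset.sum_congr rfl fun i _ => ?_
  exact key _ s (fun j hj => by simp [incidenceCount_eq_zero_of_lt_right hj])
    (fun j hj => by simp [Nat.choose_eq_zero_of_lt hj])

/-! ### Ordered Bell numbers and their asymptotics. -/

/-- The ordered Bell number `∑ r, r ^ m / 2 ^ (r + 1)`. -/
noncomputable def orderedBell (m : ℕ) : ℝ := ∑' r : ℕ, (r : ℝ) ^ m / 2 ^ (r + 1)

theorem hasSum_orderedBell (m : ℕ) :
    HasSum (fun r : ℕ => (r : ℝ) ^ m / 2 ^ (r + 1)) (orderedBell m) := by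
  refine Summable.hasSum ?_
  have h := (summable_pow_mul_geometric_of_norm_lt_one m
    (show ‖(1 / 2 : ℝ)‖ < 1 by norm_num)).mul_left (1 / 2)
  refine h.congr fun r => ?_
  rw [div_pow, pow_succ, one_pow]
  field_simp

theorem orderedBell_nonneg (m : ℕ) : 0 ≤ orderedBell m :=
  tsum_nonneg fun r => by positivity

theorem orderedBell_zero : orderedBell 0 = 1 := by
  have h := tsum_geometric_two' (1 : ℝ)
  rw [← h, orderedBell]
  refine tsum_congr fun r => ?_
  rw [pow_succ]
  field_simp

/-- Shift `r` to `r + 1` in the series, which doubles it since the term at 0 vanishes for `m ≠ 0`,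
and expand `(r + 1) ^ m`. -/
theorem orderedBell_recurrence {m : ℕ} (hm : m ≠ 0) :
    2 * orderedBell m = ∑ j ∈ Finset.range (m + 1), (m.choose j : ℝ) * orderedBell j := by
  have h1 : HasSum (fun r : ℕ => ((r : ℝ) + 1) ^ m / 2 ^ (r + 1)) (2 * orderedBell m) := by
    have := ((hasSum_nat_add_iff' 1).2 (hasSum_orderedBell m)).mul_left 2
    simp only [Finset.range_one, Finset.sum_singleton, Nat.cast_zero, zero_pow hm, zero_div,
      sub_zero] at this
    have e : (fun r : ℕ => ((r : ℝ) + 1) ^ m / 2 ^ (r + 1)) =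
        fun r : ℕ => 2 * (((r + 1 : ℕ) : ℝ) ^ m / 2 ^ (r + 1 + 1)) := by
      funext r
      push_cast
      rw [pow_succ _ (r + 1)]
      field_simp
    rwa [e]
  have h2 : HasSum (fun r : ℕ => ∑ j ∈ Finset.range (m + 1),
      (m.choose j : ℝ) * ((r : ℝ) ^ j / 2 ^ (r + 1)))
      (∑ j ∈ Finset.range (m + 1), (m.choose j : ℝ) * orderedBell j) :=
    hasSum_sum fun j _ => (hasSum_orderedBell j).mul_left _
  refine h1.unique ?_
  convert h2 using 2 with r
  rw [add_pow, Finset.sum_div]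
  refine Finset.sum_congr rfl fun j _ => ?_
  rw [one_pow]
  ring

/-- The normalised ordered Bell number `(log 2) ^ m * orderedBell m / m!`. -/
noncomputable def scaledBell (m : ℕ) : ℝ := Real.log 2 ^ m * orderedBell m / m.factorial

theorem scaledBell_nonneg (m : ℕ) : 0 ≤ scaledBell m := by
  have := orderedBell_nonneg m
  have := Real.log_pos one_lt_two
  unfold scaledBell
  positivity

theorem scaledBell_zero : scaledBell 0 = 1 := by simp [scaledBell, orderedBell_zero]

/-- The terms of the exponential series at `log 2`. -/
noncomputable def logTwoTerm (j : ℕ) : ℝ := Real.log 2 ^ j / j.factorial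

theorem logTwoTerm_nonneg (j : ℕ) : 0 ≤ logTwoTerm j := by
  have := Real.log_pos one_lt_two
  unfold logTwoTerm
  positivity

theorem hasSum_logTwoTerm : HasSum logTwoTerm 2 := by
  have h := NormedSpace.expSeries_div_hasSum_exp (Real.log 2)
  rw [← Real.exp_eq_exp_ℝ, Real.exp_log two_pos] at h
  exact h

theorem scaledBell_succ (m : ℕ) :
    scaledBell (m + 1) =
      ∑ p ∈ Finset.HasAntidiagonal.antidiagonal m, logTwoTerm (p.1 + 1) * scaledBell p.2 := by
  have h := orderedBell_recurrence (Nat.succ_ne_zero m)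
  have h' : ∑ p ∈ Finset.HasAntidiagonal.antidiagonal (m + 1), logTwoTerm p.1 * scaledBell p.2 =
      2 * scaledBell (m + 1) := by
    rw [← Finset.Nat.sum_antidiagonal_swap]
    simp only [Prod.fst_swap, Prod.snd_swap]
    rw [Finset.Nat.sum_antidiagonal_eq_sum_range_succ
      (fun i j => logTwoTerm j * scaledBell i), scaledBell, mul_div_assoc', mul_left_comm, h,
      Finset.mul_sum, Finset.sum_div]
    refine Finset.sum_congr rfl fun j hj => ?_
    have hj : j ≤ m + 1 := by simpa [Nat.lt_succ_iff] using hj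
    rw [logTwoTerm, scaledBell, Nat.cast_choose ℝ hj, ← Nat.sub_add_cancel hj]
    simp only [Nat.sub_add_cancel hj]
    rw [show Real.log 2 ^ (m + 1) = Real.log 2 ^ (m + 1 - j) * Real.log 2 ^ j by
      rw [← pow_add, Nat.sub_add_cancel hj]]
    have := Nat.factorial_ne_zero (m + 1)
    field_simp
  rw [Finset.Nat.sum_antidiagonal_succ] at h'
  have : logTwoTerm 0 = 1 := by simp [logTwoTerm]
  rw [this] at h'
  simp only at h'
  linarith

/-- The tails of the exponential series at `log 2`. -/
noncomputable def logTwoTail (i : ℕ) : ℝ := 2 - ∑ j ∈ Finset.range (i + 1), logTwoTerm j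

theorem logTwoTail_zero : logTwoTail 0 = 1 := by norm_num [logTwoTail, logTwoTerm]

theorem logTwoTail_succ (i : ℕ) : logTwoTail (i + 1) = logTwoTail i - logTwoTerm (i + 1) := by
  rw [logTwoTail, Finset.sum_range_succ, logTwoTail]
  ring

theorem hasSum_logTwoTail (i : ℕ) : HasSum (fun j => logTwoTerm (j + (i + 1))) (logTwoTail i) :=
  (hasSum_nat_add_iff' (i + 1)).2 hasSum_logTwoTerm

theorem logTwoTail_nonneg (i : ℕ) : 0 ≤ logTwoTail i :=
  (hasSum_logTwoTail i).nonneg fun _ => logTwoTerm_nonneg _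

/-- Passing to the next tail multiplies each term of the series by log 2 over an integer that is at
least 2. -/
theorem logTwoTail_le (i : ℕ) : logTwoTail i ≤ (Real.log 2 / 2) ^ i := by
  induction i with
  | zero => simp [logTwoTail_zero]
  | succ i ih =>
    have hL := Real.log_pos one_lt_two
    have h := hasSum_le (fun j => ?_) (hasSum_logTwoTail (i + 1))
      ((hasSum_logTwoTail i).mul_left (Real.log 2 / 2))
    · rw [pow_succ']
      exact h.trans (mul_le_mul_of_nonneg_left ih (by positivity))
    · rw [logTwoTerm, logTwoTerm, ← add_assoc, ← add_assoc,
        Nat.factorial_succ (j + i + 1), pow_succ']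
      push_cast
      rw [div_mul_div_comm]
      gcongr
      linarith [Nat.cast_nonneg (α := ℝ) j, Nat.cast_nonneg (α := ℝ) i]

/-- The generating function of `scaledBell` is 1 / (2 - 2^x), and that of `logTwoTail` is (2 - 2^x)
/ (1 - x), with the zero at x = 1 divided out. Their product is 1 / (1 - x). -/
theorem sum_logTwoTail_mul_scaledBell (m : ℕ) :
    ∑ p ∈ Finset.HasAntidiagonal.antidiagonal m, logTwoTail p.1 * scaledBell p.2 = 1 := by
  induction m with
  | zero => simp [logTwoTail_zero, scaledBell_zero]
  | succ m ih =>
    rw [Finset.Nat.sum_antidiagonal_succ]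
    simp only [logTwoTail_succ, sub_mul, Finset.sum_sub_distrib, logTwoTail_zero]
    rw [ih, scaledBell_succ]
    ring

theorem scaledBell_le_one (m : ℕ) : scaledBell m ≤ 1 := by
  rw [← sum_logTwoTail_mul_scaledBell m]
  have := Finset.single_le_sum (f := fun p : ℕ × ℕ => logTwoTail p.1 * scaledBell p.2)
    (fun p _ => mul_nonneg (logTwoTail_nonneg p.1) (scaledBell_nonneg p.2))
    (show (0, m) ∈ Finset.HasAntidiagonal.antidiagonal m by simp)
  simpa [logTwoTail_zero] using this

/-- Summation by parts; it serves to evaluate the full sum of the tails. -/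
theorem sum_logTwoTail (n : ℕ) : ∑ i ∈ Finset.range n, logTwoTail i =
    n * logTwoTail n + Real.log 2 * ∑ j ∈ Finset.range n, logTwoTerm j := by
  induction n with
  | zero => simp
  | succ n ih =>
    rw [Finset.sum_range_succ, ih, Finset.sum_range_succ, logTwoTail_succ]
    have : Real.log 2 * logTwoTerm n = (n + 1) * logTwoTerm (n + 1) := by
      rw [logTwoTerm, logTwoTerm, Nat.factorial_succ]
      push_cast
      field_simp
      ring
    rw [mul_add, this]
    push_cast
    ring

theorem half_log_two_lt : Real.log 2 / 2 < 7 / 20 := by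
  have := Real.log_two_lt_d9
  norm_num at this ⊢
  linarith

theorem hasSum_logTwoTail_two_mul : HasSum logTwoTail (2 * Real.log 2) := by
  have hL := Real.log_pos one_lt_two
  rw [hasSum_iff_tendsto_nat_of_nonneg logTwoTail_nonneg]
  simp only [sum_logTwoTail]
  have h1 : Tendsto (fun n : ℕ => (n : ℝ) * logTwoTail n) atTop (𝓝 0) :=
    squeeze_zero (fun n => mul_nonneg n.cast_nonneg (logTwoTail_nonneg n))
      (fun n => mul_le_mul_of_nonneg_left (logTwoTail_le n) n.cast_nonneg)
      (tendsto_self_mul_const_pow_of_lt_one (by positivity) (by linarith [half_log_two_lt]))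
  have h2 := h1.add (hasSum_logTwoTerm.tendsto_sum_nat.const_mul (Real.log 2))
  rwa [zero_add, mul_comm] at h2

/-- The deviation `d`, convolved with `logTwoTail`, gives a remainder of the series for 2 log 2,
which is exponentially small. As `logTwoTail 0 = 1`, this expresses `d m` through earlier values,
and strong induction applies. -/
theorem abs_two_mul_log_two_mul_scaledBell_sub_one_le (m : ℕ) :
    |2 * Real.log 2 * scaledBell m - 1| ≤ 10 * (4 / 5) ^ m := by
  have hL := Real.log_pos one_lt_two
  set a : ℝ := Real.log 2 / 2 with ha
  have ha0 : 0 < a := by positivity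
  have ha1 : a < 7 / 20 := half_log_two_lt
  set d : ℕ → ℝ := fun m => 2 * Real.log 2 * scaledBell m - 1 with hd
  have htail (m : ℕ) : 2 * Real.log 2 - ∑ i ∈ Finset.range (m + 1), logTwoTail i ≤ a ^ m := by
    have h1 := (hasSum_nat_add_iff' (m + 1)).2 hasSum_logTwoTail_two_mul
    have h2 := (hasSum_geometric_of_lt_one ha0.le (by linarith)).mul_left (a ^ (m + 1))
    refine (hasSum_le (fun i => ?_) h1 h2).trans ?_
    · rw [← pow_add, add_comm]
      exact logTwoTail_le _
    · rw [pow_succ, mul_assoc]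
      refine mul_le_of_le_one_right (by positivity) ?_
      rw [← div_eq_mul_inv, div_le_one (by linarith)]
      linarith
  have htail0 (m : ℕ) : 0 ≤ 2 * Real.log 2 - ∑ i ∈ Finset.range (m + 1), logTwoTail i :=
    sub_nonneg.2 (sum_le_hasSum _ (fun i _ => logTwoTail_nonneg i) hasSum_logTwoTail_two_mul)
  have hconv (m : ℕ) : ∑ p ∈ Finset.HasAntidiagonal.antidiagonal m, logTwoTail p.1 * d p.2 =
      2 * Real.log 2 - ∑ i ∈ Finset.range (m + 1), logTwoTail i := by
    have := Finset.Nat.sum_antidiagonal_eq_sum_range_succ (fun i _ => logTwoTail i) m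
    rw [← this, ← mul_one (2 * Real.log 2), ← sum_logTwoTail_mul_scaledBell m, Finset.mul_sum,
      ← Finset.sum_sub_distrib]
    refine Finset.sum_congr rfl fun p _ => ?_
    simp only [hd]
    ring
  induction m using Nat.strong_induction_on with
  | _ m ih =>
    change |d m| ≤ _
    cases m with
    | zero =>
      have h := hconv 0
      simp only [Finset.HasAntidiagonal.antidiagonal_zero, Finset.sum_singleton, logTwoTail_zero,
        one_mul] at h
      rw [h, abs_of_nonneg (htail0 0)]
      exact (htail 0).trans (by norm_num)
    | succ m =>
      have h := hconv (m + 1)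
      rw [Finset.Nat.sum_antidiagonal_succ] at h
      simp only [logTwoTail_zero, one_mul] at h
      -- The ratio (7/20) / (4/5) is 7/16, and its geometric series from the first power sums to
      -- 7/9. Since 7/9 < 1, the induction closes: the constant 10 leaves 20/9 for the remainder,
      -- which needs only 7/16.
      have hgeo : ∑ p ∈ Finset.HasAntidiagonal.antidiagonal m,
          (7 / 20 : ℝ) ^ (p.1 + 1) * (4 / 5) ^ p.2 ≤
          7 / 9 * (4 / 5) ^ (m + 1) := by
        clear * -
        induction m with
        | zero => norm_num
        | succ m ih =>
          rw [Finset.Nat.sum_antidiagonal_succ]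
          simp only [pow_succ _ (_ + 1), mul_right_comm _ (7 / 20 : ℝ), ← Finset.sum_mul]
          rw [zero_add, pow_one]
          linarith [show (0 : ℝ) < (4 / 5) ^ (m + 1) by positivity]
      have hsum : |∑ p ∈ Finset.HasAntidiagonal.antidiagonal m, logTwoTail (p.1 + 1) * d p.2| ≤
          10 * (7 / 9 * (4 / 5) ^ (m + 1)) := by
        refine (Finset.abs_sum_le_sum_abs _ _).trans (le_trans (Finset.sum_le_sum fun p hp => ?_)
          ((Finset.mul_sum _ _ _).symm.le.trans (mul_le_mul_of_nonneg_left hgeo (by norm_num))))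
        have hp : p.1 + p.2 = m := by simpa using hp
        rw [abs_mul, abs_of_nonneg (logTwoTail_nonneg _), mul_left_comm]
        refine mul_le_mul ?_ (ih p.2 (by omega)) (abs_nonneg _) (by positivity)
        exact (logTwoTail_le _).trans (pow_le_pow_left₀ ha0.le ha1.le _)
      have heps : a ^ (m + 1) ≤ (7 / 20) * (4 / 5) ^ m := by
        rw [pow_succ']
        exact mul_le_mul ha1.le (pow_le_pow_left₀ ha0.le (by linarith) _) (by positivity)
          (by norm_num)
      have h1 := htail (m + 1)
      have h0 := htail0 (m + 1)
      have hpow : (0 : ℝ) < (4 / 5) ^ m := by positivity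
      rw [abs_le] at hsum ⊢
      rw [pow_succ'] at hsum ⊢
      constructor <;> linarith [hsum.1, hsum.2]

theorem tendsto_two_mul_log_two_mul_scaledBell :
    Tendsto (fun m => 2 * Real.log 2 * scaledBell m) atTop (𝓝 1) := by
  rw [tendsto_iff_norm_sub_tendsto_zero]
  refine squeeze_zero (fun _ => norm_nonneg _) abs_two_mul_log_two_mul_scaledBell_sub_one_le ?_
  simpa using (tendsto_pow_atTop_nhds_zero_of_lt_one (r := (4 / 5 : ℝ)) (by norm_num)
    (by norm_num)).const_mul 10

/-! ### Stirling numbers of the first kind and their asymptotics. -/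

/-- The `k`-th elementary symmetric function of `0, 1, …, n - 1`, that is the unsigned Stirling
number of the first kind `c(n, n - k)`. -/
def esymmRange : ℕ → ℕ → ℕ
  | 0, 0 => 1
  | 0, _ + 1 => 0
  | n + 1, 0 => esymmRange n 0
  | n + 1, k + 1 => esymmRange n (k + 1) + n * esymmRange n k

theorem esymmRange_zero_right (n : ℕ) : esymmRange n 0 = 1 := by
  induction n with
  | zero => rfl
  | succ n ih => rw [esymmRange, ih]

theorem esymmRange_succ_succ (n k : ℕ) :
    esymmRange (n + 1) (k + 1) = esymmRange n (k + 1) + n * esymmRange n k := by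
  rw [esymmRange]

theorem esymmRange_eq_zero_of_lt {n k : ℕ} (h : n < k) : esymmRange n k = 0 := by
  induction n generalizing k with
  | zero => obtain ⟨k, rfl⟩ := Nat.exists_eq_succ_of_ne_zero (by omega : k ≠ 0); rfl
  | succ n ih =>
    obtain ⟨k, rfl⟩ := Nat.exists_eq_succ_of_ne_zero (by omega : k ≠ 0)
    rw [Nat.succ_eq_add_one, esymmRange_succ_succ, ih (by omega), ih (by omega)]
    simp

theorem descFactorial_eq_sum_esymmRange (n x : ℕ) :
    (x.descFactorial n : ℝ) =
      ∑ k ∈ Finset.range (n + 1), (-1) ^ k * (esymmRange n k : ℝ) * (x : ℝ) ^ (n - k) := by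
  induction n with
  | zero => simp [esymmRange]
  | succ n ih =>
    -- For `x < n` the real factor is negative, not truncated to 0, but then `x.descFactorial n` is
    -- already 0.
    have h1 : ((x.descFactorial (n + 1) : ℕ) : ℝ) = (x - n : ℝ) * x.descFactorial n := by
      rw [Nat.descFactorial_succ, Nat.cast_mul]
      rcases le_or_gt n x with h | h
      · rw [Nat.cast_sub h]
      · rw [Nat.descFactorial_of_lt h]; simp
    have h2 : (x : ℝ) * (x.descFactorial n : ℝ) =
        ∑ k ∈ Finset.range (n + 2), (-1) ^ k * (esymmRange n k : ℝ) * (x : ℝ) ^ (n + 1 - k) := by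
      rw [Finset.sum_range_succ, esymmRange_eq_zero_of_lt (Nat.lt_succ_self n), ih,
        Finset.mul_sum]
      simp only [Nat.cast_zero, mul_zero, zero_mul, add_zero]
      refine Finset.sum_congr rfl fun k hk => ?_
      rw [Nat.succ_sub (by simpa [Nat.lt_succ_iff] using hk), pow_succ]
      ring
    rw [h1, sub_mul, h2, Finset.sum_range_succ', Finset.sum_range_succ' _ (n + 1), ih,
      Finset.mul_sum, add_sub_right_comm, ← Finset.sum_sub_distrib]
    simp only [esymmRange_succ_succ, esymmRange_zero_right]
    congr 1
    refine Finset.sum_congr rfl fun k _ => ?_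
    rw [Nat.add_sub_add_right]
    push_cast
    ring

/-- This bound, uniform in `n` and `k`, supplies the domination in the final limit. The induction
rests on n² + n ≤ (n + 1)². -/
theorem esymmRange_mul_factorial_sq_le (n k : ℕ) :
    esymmRange n k * (n - k).factorial ^ 2 ≤ n.factorial ^ 2 := by
  induction n generalizing k with
  | zero => cases k <;> simp [esymmRange]
  | succ n ih =>
    cases k with
    | zero => simp [esymmRange_zero_right]
    | succ k =>
      have h1 : esymmRange n (k + 1) * (n - k).factorial ^ 2 ≤ n ^ 2 * n.factorial ^ 2 := by
        rcases le_or_gt n k with h | h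
        · simp [esymmRange_eq_zero_of_lt (Nat.lt_succ_of_le h)]
        · obtain ⟨d, rfl⟩ := Nat.exists_eq_add_of_lt h
          have := ih (k + 1)
          rw [show k + d + 1 - (k + 1) = d by omega] at this
          rw [show k + d + 1 - k = d + 1 by omega, Nat.factorial_succ, mul_pow, mul_left_comm]
          exact Nat.mul_le_mul (Nat.pow_le_pow_left (by omega) 2) this
      have h2 := Nat.mul_le_mul_left n (ih k)
      rw [esymmRange_succ_succ, Nat.add_sub_add_right, Nat.factorial_succ, mul_pow]
      nlinarith [Nat.zero_le (n.factorial ^ 2), Nat.zero_le (n * n.factorial ^ 2)]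

/-- This is the derivative of `x ^ (m + 1)` at 1, taken along the increments 1/n. -/
theorem tendsto_pow_sub_pow_div_pow (m : ℕ) :
    Tendsto (fun n : ℕ => (((n : ℝ) + 1) ^ (m + 1) - (n : ℝ) ^ (m + 1)) / (n : ℝ) ^ m) atTop
      (𝓝 (m + 1)) := by
  have h0 : HasDerivAt (fun x : ℝ => x ^ (m + 1)) (((m + 1 : ℕ) : ℝ) * 1 ^ m) 1 := by
    simpa using hasDerivAt_pow (m + 1) (1 : ℝ)
  have h1 := (hasDerivAt_iff_tendsto_slope_zero.1 h0).comp
    (tendsto_nhdsWithin_iff.2 ⟨tendsto_inv_atTop_nhds_zero_nat (𝕜 := ℝ),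
      (eventually_gt_atTop 0).mono fun n hn => by simp; omega⟩)
  simp only [one_pow, mul_one] at h1
  push_cast at h1
  refine h1.congr' ((eventually_gt_atTop 0).mono fun n hn => ?_)
  have hn' : (n : ℝ) ≠ 0 := by positivity
  simp only [Function.comp, smul_eq_mul]
  rw [show (1 : ℝ) + (n : ℝ)⁻¹ = (n + 1) / n by field_simp]
  rw [div_pow]
  field_simp
  ring

/-- A Stolz–Cesàro argument: `esymmRange n (k + 1)` is the sum of `i * esymmRange i k` over `i < n`,
compared termwise with the increments `g i`, which telescope to `n ^ (2 * k + 2)`. -/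
theorem tendsto_esymmRange_div_pow (k : ℕ) :
    Tendsto (fun n : ℕ => (esymmRange n k : ℝ) / (n : ℝ) ^ (2 * k)) atTop
      (𝓝 (1 / (2 ^ k * k.factorial))) := by
  induction k with
  | zero => simp [esymmRange_zero_right]
  | succ k ih =>
    set g : ℕ → ℝ := fun n => ((n : ℝ) + 1) ^ (2 * k + 2) - (n : ℝ) ^ (2 * k + 2) with hg
    set c : ℝ := 1 / (2 ^ (k + 1) * (k + 1).factorial) with hc
    have hgsum : ∀ n, ∑ i ∈ Finset.range n, g i = (n : ℝ) ^ (2 * k + 2) := fun n => by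
      have := Finset.sum_range_sub (fun i : ℕ => (i : ℝ) ^ (2 * k + 2)) n
      simpa [hg] using this
    have hgpos : ∀ n, 0 < g n := fun n => by
      simp only [hg, sub_pos]
      exact pow_lt_pow_left₀ (by linarith) (by positivity) (by omega)
    have hbsum : ∀ n, ∑ i ∈ Finset.range n, ((i : ℝ) * esymmRange i k) =
        (esymmRange n (k + 1) : ℝ) := fun n => by
      induction n with
      | zero => simp [esymmRange]
      | succ n ihn =>
        rw [Finset.sum_range_succ, ihn, esymmRange_succ_succ]
        push_cast
        ring
    have hg1 : Tendsto (fun n : ℕ => g n / (n : ℝ) ^ (2 * k + 1)) atTop (𝓝 (2 * k + 2)) := by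
      have := tendsto_pow_sub_pow_div_pow (2 * k + 1)
      push_cast at this
      convert this using 2
      ring
    have hlim : Tendsto (fun n : ℕ => ((n : ℝ) * esymmRange n k) / g n) atTop (𝓝 c) := by
      have h := ih.div hg1 (by positivity)
      have e : (1 / (2 ^ k * k.factorial) : ℝ) / (2 * k + 2) = c := by
        rw [hc, Nat.factorial_succ]
        push_cast
        field_simp
        ring
      rw [e] at h
      refine h.congr' ((eventually_gt_atTop 0).mono fun n hn => ?_)
      have hn' : (n : ℝ) ≠ 0 := by positivity
      have := (hgpos n).ne'
      simp only [Pi.div_apply]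
      rw [pow_succ]
      field_simp
    have ho : (fun n : ℕ => (n : ℝ) * esymmRange n k - c * g n) =o[atTop] g := by
      rw [Asymptotics.isLittleO_iff_tendsto' (Eventually.of_forall fun n h =>
        absurd h (hgpos n).ne')]
      have := hlim.sub_const c
      rw [sub_self] at this
      refine this.congr fun n => ?_
      have := (hgpos n).ne'
      field_simp
    have htop : Tendsto (fun n => ∑ i ∈ Finset.range n, g i) atTop atTop := by
      simp only [hgsum]
      exact (tendsto_pow_atTop (by omega)).comp tendsto_natCast_atTop_atTop
    have hs := ho.sum_range (fun n => (hgpos n).le) htop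
    simp only [Finset.sum_sub_distrib, ← Finset.mul_sum, hgsum, hbsum] at hs
    have ht := hs.tendsto_div_nhds_zero.add_const c
    rw [zero_add] at ht
    refine ht.congr' ((eventually_gt_atTop 0).mono fun n hn => ?_)
    have hn' : (n : ℝ) ≠ 0 := by positivity
    rw [mul_add, mul_one]
    field_simp
    ring

theorem tendsto_factorial_sub_mul_pow_div_factorial (k : ℕ) :
    Tendsto (fun n : ℕ => ((n - k).factorial : ℝ) * (n : ℝ) ^ k / n.factorial) atTop (𝓝 1) := by
  induction k with
  | zero =>
    refine tendsto_const_nhds.congr fun n => ?_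
    have : (n.factorial : ℝ) ≠ 0 := by positivity
    simp [this]
  | succ k ih =>
    have h : Tendsto (fun n : ℕ => (n : ℝ) / (n + (-k : ℝ))) atTop (𝓝 1) :=
      tendsto_natCast_div_add_atTop (-k : ℝ)
    have := ih.mul h
    rw [one_mul] at this
    refine this.congr' ((eventually_gt_atTop k).mono fun n hn => ?_)
    obtain ⟨d, rfl⟩ := Nat.exists_eq_add_of_lt hn
    simp only
    rw [show k + d + 1 - (k + 1) = d by omega, show k + d + 1 - k = d + 1 by omega,
      Nat.factorial_succ]
    have : ((k + d + 1).factorial : ℝ) ≠ 0 := by positivity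
    have : (d + 1 : ℝ) ≠ 0 := by positivity
    push_cast
    rw [show (k + d + 1 + -k : ℝ) = d + 1 by ring]
    field_simp
    ring

theorem tendsto_esymmRange_mul_factorial_sq (k : ℕ) :
    Tendsto (fun n : ℕ => (esymmRange n k : ℝ) * ((n - k).factorial : ℝ) ^ 2 /
      (n.factorial : ℝ) ^ 2) atTop (𝓝 (1 / (2 ^ k * k.factorial))) := by
  have h := (tendsto_esymmRange_div_pow k).mul
    ((tendsto_factorial_sub_mul_pow_div_factorial k).pow 2)
  rw [one_pow, mul_one] at h
  refine h.congr' ((eventually_gt_atTop 0).mono fun n hn => ?_)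
  have hn' : (n : ℝ) ≠ 0 := by positivity
  rw [pow_mul']
  field_simp

/-! ### Exact formula for `F1111`. -/

theorem hasSum_choose_div_two_pow (i : ℕ) :
    HasSum (fun r : ℕ => (r.choose i : ℝ) / 2 ^ (r + 1)) 1 := by
  rw [← hasSum_nat_add_iff' i, Finset.sum_eq_zero fun j hj => by
    rw [Nat.choose_eq_zero_of_lt (Finset.mem_range.1 hj), Nat.cast_zero, zero_div], sub_zero]
  have h := (hasSum_choose_mul_geometric_of_norm_lt_one i
    (show ‖(1 / 2 : ℝ)‖ < 1 by norm_num)).mul_left (1 / 2 ^ (i + 1))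
  convert! h using 1
  · ext r
    rw [div_pow, one_pow, pow_succ, pow_succ, pow_add]
    field_simp
  · rw [show (1 - 1 / 2 : ℝ) = 1 / 2 by norm_num, div_pow, one_pow]
    field_simp

theorem HasSum.mul_prod_of_nonneg {f g : ℕ → ℝ} {a b : ℝ} (hf : HasSum f a) (hg : HasSum g b)
    (hf0 : ∀ i, 0 ≤ f i) (hg0 : ∀ i, 0 ≤ g i) :
    HasSum (fun p : ℕ × ℕ => f p.1 * g p.2) (a * b) :=
  hf.mul hg (hf.summable.mul_of_nonneg hg.summable hf0 hg0)

theorem hasSum_choose_mul_div_two_pow (n : ℕ) :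
    HasSum (fun p : ℕ × ℕ => ((p.1 * p.2).choose n : ℝ) / (2 ^ (p.1 + 1) * 2 ^ (p.2 + 1)))
      (F1111 n) := by
  have h := hasSum_sum (s := Finset.range (n + 1)) fun i _ =>
    hasSum_sum (s := Finset.range (n + 1)) fun j _ =>
      ((hasSum_choose_div_two_pow i).mul_prod_of_nonneg (hasSum_choose_div_two_pow j)
        (fun _ => by positivity) (fun _ => by positivity)).mul_right (incidenceCount i j n : ℝ)
  convert! h using 1
  · ext p
    rw [choose_mul_eq_sum_incidenceCount]
    push_cast
    simp only [Finset.sum_div]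
    refine Finset.sum_congr rfl fun i _ => Finset.sum_congr rfl fun j _ => ?_
    field_simp
  · rw [F1111_eq_sum_incidenceCount]
    simp

theorem factorial_mul_F1111 (n : ℕ) : (n.factorial : ℝ) * F1111 n =
    ∑ k ∈ Finset.range (n + 1), (-1) ^ k * (esymmRange n k : ℝ) * orderedBell (n - k) ^ 2 := by
  have h := hasSum_sum (s := Finset.range (n + 1)) fun k _ =>
    ((hasSum_orderedBell (n - k)).mul_prod_of_nonneg (hasSum_orderedBell (n - k))
      (fun _ => by positivity) (fun _ => by positivity)).mul_left
        ((-1) ^ k * (esymmRange n k : ℝ))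
  simp only [sq]
  refine HasSum.unique ((hasSum_choose_mul_div_two_pow n).mul_left (n.factorial : ℝ)) ?_
  convert h using 1
  ext p
  rw [mul_div_assoc', ← Nat.cast_mul, ← Nat.descFactorial_eq_factorial_mul_choose,
    descFactorial_eq_sum_esymmRange, Finset.sum_div]
  refine Finset.sum_congr rfl fun k _ => ?_
  rw [Nat.cast_mul, mul_pow]
  field_simp

/-! ### Passage to the limit. -/

/-- The `k`-th term of the alternating expansion of `F1111 n`, divided by the main term without
its exponential factor. -/
noncomputable def normalizedTerm (n k : ℕ) : ℝ :=
  (-(Real.log 2 ^ 2)) ^ k *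
    ((esymmRange n k : ℝ) * ((n - k).factorial : ℝ) ^ 2 / (n.factorial : ℝ) ^ 2) *
      (2 * Real.log 2 * scaledBell (n - k)) ^ 2

theorem tsum_normalizedTerm (n : ℕ) :
    ∑' k, normalizedTerm n k =
      F1111 n / ((n.factorial : ℝ) / 4 * (1 / Real.log 2 ^ (2 * n + 2))) := by
  have hL := Real.log_pos one_lt_two
  have hn : (n.factorial : ℝ) ≠ 0 := by positivity
  -- Beyond `k = n`, where `n - k` is truncated, `esymmRange n k` vanishes.
  rw [tsum_eq_sum (s := Finset.range (n + 1)) fun k hk => by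
    rw [normalizedTerm, esymmRange_eq_zero_of_lt (by simpa using hk)]; simp]
  have hF : (F1111 n : ℝ) = (n.factorial * F1111 n : ℝ) / n.factorial := by field_simp
  rw [hF, factorial_mul_F1111, Finset.sum_div, Finset.sum_div]
  refine Finset.sum_congr rfl fun k hk => ?_
  obtain ⟨m, rfl⟩ := Nat.exists_eq_add_of_le (show k ≤ n by simpa [Nat.lt_succ_iff] using hk)
  rw [normalizedTerm, scaledBell, neg_pow, Nat.add_sub_cancel_left]
  have : (m.factorial : ℝ) ≠ 0 := by positivity
  field_simp
  ring

theorem tendsto_tsum_normalizedTerm :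
    Tendsto (fun n => ∑' k, normalizedTerm n k) atTop
      (𝓝 (Real.exp (-(1 / 2) * Real.log 2 ^ 2))) := by
  have hL := Real.log_pos one_lt_two
  have hL1 : Real.log 2 < 1 := by linarith [Real.log_two_lt_d9]
  have hexp := NormedSpace.expSeries_div_hasSum_exp (-(1 / 2) * Real.log 2 ^ 2)
  rw [← Real.exp_eq_exp_ℝ] at hexp
  rw [← hexp.tsum_eq]
  -- The factorial quotient and `scaledBell` are both at most 1, and log 2 < 1 makes the remaining
  -- geometric bound summable.
  refine tendsto_tsum_of_dominated_convergence
    (bound := fun k => (Real.log 2 ^ 2) ^ k * (2 * Real.log 2) ^ 2) ?_ (fun k => ?_)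
    (Eventually.of_forall fun n k => ?_)
  · exact (summable_geometric_of_lt_one (by positivity)
      (pow_lt_one₀ hL.le hL1 two_ne_zero)).mul_right _
  · have h := ((tendsto_esymmRange_mul_factorial_sq k).const_mul ((-(Real.log 2 ^ 2)) ^ k)).mul
      ((tendsto_two_mul_log_two_mul_scaledBell.comp (tendsto_sub_atTop_nat k)).pow 2)
    refine (congrArg _ (congrArg 𝓝 ?_)).mp h
    rw [one_pow, mul_one, neg_mul, neg_pow, neg_pow (1 / 2 * Real.log 2 ^ 2), mul_pow, div_pow,
      one_pow]
    field_simp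
  · rw [normalizedTerm, norm_mul, norm_mul, norm_pow, norm_neg, Real.norm_of_nonneg (by positivity)]
    have h1 : (esymmRange n k : ℝ) * ((n - k).factorial : ℝ) ^ 2 / (n.factorial : ℝ) ^ 2 ≤ 1 := by
      rw [div_le_one (by positivity)]
      exact_mod_cast esymmRange_mul_factorial_sq_le n k
    have h2 := scaledBell_nonneg (n - k)
    rw [Real.norm_of_nonneg (by positivity), Real.norm_of_nonneg (by positivity)]
    refine mul_le_mul (mul_le_of_le_one_right (by positivity) h1) ?_ (by positivity)
      (by positivity)
    exact pow_le_pow_left₀ (by positivity)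
      (mul_le_of_le_one_right (by positivity) (scaledBell_le_one _)) 2

theorem theorem1 :
    Tendsto
      (fun n : ℕ => (F1111 n : ℝ) /
        ((n.factorial : ℝ) / 4 * Real.exp (-(1 / 2) * (Real.log 2) ^ 2) *
          (1 / (Real.log 2) ^ (2 * n + 2))))
      atTop (𝓝 1) := by
  have h := tendsto_tsum_normalizedTerm.div_const (Real.exp (-(1 / 2) * Real.log 2 ^ 2))
  rw [div_self (Real.exp_ne_zero _)] at h
  refine h.congr fun n => ?_
  rw [tsum_normalizedTerm, div_div, mul_right_comm]
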